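/- Let $\mathbb F$ be a field. A Leibniz algebra is an $\mathbb F$-vector space $L$ with a bilinear multiplication satisfying $x(yz)=(xy)z+y(xz)$. Write $L'$ for the span of all products $xy$, and $Z(L)=\{z\in L: zx=xz=0 \text{ for all } x\in L\}$. A \emph{defining pair} for $L$ is a Leibniz algebra $K$ with an ideal $M\subseteq Z(K)\cap K'$ such that $K/M\cong L$; when $\dim K$ is maximal among all defining pairs for $L$, the space $M$, unique up to isomorphism, is the \emph{multiplier} $M(L)$. Let $Z^*(L)$ be the intersection of all images $\varphi(Z(E))$, where $\varphi:E\to L$ is a surjective homomorphism of Leibniz algebras with $\ker\varphi\subseteq Z(E)$. Let $H^2(L,\mathbb F)=\mathcal Z^2/\mathcal B^2$, where $\mathcal Z^2$ is the space of bilinear forms $f$ on $L$ with $f(x,yz)=f(xy,z)+f(y,xz)$ and $\mathcal B^2$ is the space of forms $f(x,y)=-\varepsilon(xy)$ in $\mathcal Z^2$ with $\varepsilon:L\to\mathbb F$ linear. Let $L$ be a finite-dimensional Leibniz algebra and $Z$ a central ideal of $L$, i.e. an ideal $Z\subseteq Z(L)$. Let $\pi:F\to L$ be any surjective homomorphism from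 a free Leibniz algebra $F$, and let $R=\ker\pi$, $T=\pi^{-1}(Z)$. Consider the following maps. * $\delta:H^2(L,\mathbb F)\to (L/L'\otimes Z)\oplus(Z\otimes L/L')$ sends the class of $f$ to the pair of bilinear forms $(x+L',z)\mapsto f(x,z)$ and $(z,x+L')\mapsto f(z,x)$, where bilinear forms $V\times W\to\mathbb F$ on finite-dimensional spaces are identified with elements of $V\otimes W$ by a fixed linear isomorphism. * $\beta:\dfrac{R\cap F'}{FR+RF}\to\dfrac{T\cap F'}{FT+TF}$ is the natural map, induced by the inclusion $R\cap F'\subseteq T\cap F'$. * $\mathrm{Tra}:\mathrm{Hom}(Z,\mathbb F)\to H^2(L/Z,\mathbb F)$ sends $\chi$ to the class of $(x,y)\mapsto\chi(\mu(x)\mu(y)-\mu(xy))$, where $\mu$ is a linear section of $L\to L/Z$. Then $$M(L)\cong H^2(L,\mathbb F)\cong \frac{R\cap F'}{FR+RF},\qquad M(L/Z)\cong H^2(L/Z,\mathbb F)\cong\frac{T\cap F'}{FT+TF}$$ (in particular the multipliers exist), and, with these identifications, so that $\delta$ is a map $M(L)\to (L/L'\otimes Z)\oplus(Z\otimes L/L')$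 and $\beta$ a map $M(L)\to M(L/Z)$, the following are equivalent: 1. $\delta$ is the zero map; 2. $\beta$ is injective; 3. $M(L)\cong M(L/Z)/(L'\cap Z)$, where $L'\cap Z$ is identified, by an injective linear map, with its image in $M(L/Z)=H^2(L/Z,\mathbb F)$, namely the image of $\mathrm{Tra}$; 4. $Z\subseteq Z^*(L)$. -/

import Mathlib

open scoped TensorProduct

set_option maxSynthPendingDepth 3

universe u v w

namespace Leib

/-! ## Leibniz algebras

A (not necessarily associative, not necessarily unital) algebra over a field `𝔽` is given by the
instances `NonUnitalNonAssocRing L`, `Module 𝔽 L`, `IsScalarTower 𝔽 L L`, `SMulCommClass 𝔽 L L`,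
which say exactly that `L` is a vector space with a bilinear multiplication. -/

/-- The (left) Leibniz identity `x(yz) = (xy)z + y(xz)`. -/
class IsLeibniz (L : Type*) [NonUnitalNonAssocRing L] : Prop where
  leibniz : ∀ x y z : L, x * (y * z) = (x * y) * z + y * (x * z)

/-- Two-sided ideals of a nonassociative algebra. -/
structure AlgIdeal (𝔽 : Type u) (A : Type v) [Field 𝔽] [NonUnitalNonAssocRing A] [Module 𝔽 A]
    extends Submodule 𝔽 A where
  mul_mem_left : ∀ (a : A) {x : A}, x ∈ carrier → a * x ∈ carrier
  mul_mem_right : ∀ {x : A} (a : A), x ∈ carrier → x * a ∈ carrier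

section Algebra

variable {𝔽 : Type u} {A : Type v} [Field 𝔽] [NonUnitalNonAssocRing A] [Module 𝔽 A]

/-- The kernel of a homomorphism. -/
def ker {B : Type w} [NonUnitalNonAssocRing B] [Module 𝔽 B] (φ : A →ₙₐ[𝔽] B) : Submodule 𝔽 A where
  carrier := {a | φ a = 0}
  zero_mem' := map_zero φ
  add_mem' := fun {a b} (ha : φ a = 0) (hb : φ b = 0) => by simp [ha, hb]
  smul_mem' := fun c a (ha : φ a = 0) => by simp [ha]

/-- The preimage of a subspace under a homomorphism. -/
def preimage {B : Type w} [NonUnitalNonAssocRing B] [Module 𝔽 B] (φ : A →ₙₐ[𝔽] B)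
    (S : Submodule 𝔽 B) : Submodule 𝔽 A where
  carrier := {a | φ a ∈ S}
  zero_mem' := by simp
  add_mem' := fun {a b} (ha : φ a ∈ S) (hb : φ b ∈ S) => by simp [S.add_mem ha hb]
  smul_mem' := fun c a (ha : φ a ∈ S) => by simp [S.smul_mem c ha]

theorem ker_le_preimage {B : Type w} [NonUnitalNonAssocRing B] [Module 𝔽 B] (φ : A →ₙₐ[𝔽] B)
    (S : Submodule 𝔽 B) : ker φ ≤ preimage φ S := fun a (ha : φ a = 0) => by
  change φ a ∈ S
  rw [ha]
  exact S.zero_mem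

namespace AlgIdeal

/-- The ideal generated by a set: the intersection of all ideals that contain it. -/
def span (𝔽 : Type u) {A : Type v} [Field 𝔽] [NonUnitalNonAssocRing A] [Module 𝔽 A]
    (s : Set A) : AlgIdeal 𝔽 A where
  carrier := {a | ∀ I : AlgIdeal 𝔽 A, s ⊆ I.carrier → a ∈ I.carrier}
  zero_mem' := fun I _ => I.zero_mem'
  add_mem' := fun ha hb I hI => I.add_mem' (ha I hI) (hb I hI)
  smul_mem' := fun c _ ha I hI => I.smul_mem' c (ha I hI)
  mul_mem_left := fun a _ hx I hI => I.mul_mem_left a (hx I hI)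
  mul_mem_right := fun a hx I hI => I.mul_mem_right a (hx I hI)

theorem subset_span (s : Set A) : s ⊆ (span 𝔽 s).carrier := fun _ ha _ hI => hI ha

/-- The quotient `A / I` of an algebra by an ideal. -/
def Quotient (I : AlgIdeal 𝔽 A) : Type v := A ⧸ I.toSubmodule

instance (I : AlgIdeal 𝔽 A) : AddCommGroup I.Quotient :=
  inferInstanceAs (AddCommGroup (A ⧸ I.toSubmodule))

instance (I : AlgIdeal 𝔽 A) : Module 𝔽 I.Quotient :=
  inferInstanceAs (Module 𝔽 (A ⧸ I.toSubmodule))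

/-- The natural projection `A → A / I`. -/
def proj (I : AlgIdeal 𝔽 A) : A →ₗ[𝔽] I.Quotient := I.toSubmodule.mkQ

theorem proj_surjective (I : AlgIdeal 𝔽 A) : Function.Surjective I.proj :=
  I.toSubmodule.mkQ_surjective

theorem proj_eq_zero (I : AlgIdeal 𝔽 A) {a : A} : I.proj a = 0 ↔ a ∈ I.toSubmodule :=
  Submodule.Quotient.mk_eq_zero _

variable [IsScalarTower 𝔽 A A] [SMulCommClass 𝔽 A A]

/-- The multiplication `(a + I)(b + I) = ab + I`. -/
def mulQ (I : AlgIdeal 𝔽 A) : I.Quotient →ₗ[𝔽] I.Quotient →ₗ[𝔽] I.Quotient :=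
  I.toSubmodule.liftQ
    { toFun := fun a => I.toSubmodule.mapQ I.toSubmodule (LinearMap.mul 𝔽 A a)
        (fun _ hx => I.mul_mem_left a hx)
      map_add' := fun a b => by
        apply Submodule.linearMap_qext
        ext x
        exact congrArg I.toSubmodule.mkQ (add_mul a b x)
      map_smul' := fun c a => by
        apply Submodule.linearMap_qext
        ext x
        exact congrArg I.toSubmodule.mkQ (smul_mul_assoc c a x) }
    (fun a ha => by
      rw [LinearMap.mem_ker]
      apply Submodule.linearMap_qext
      ext x
      exact (Submodule.Quotient.mk_eq_zero _).2 (I.mul_mem_right x ha))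

instance (I : AlgIdeal 𝔽 A) : NonUnitalNonAssocRing I.Quotient :=
  { (inferInstance : AddCommGroup I.Quotient) with
    mul := fun x y => I.mulQ x y
    left_distrib := fun x y z => (I.mulQ x).map_add y z
    right_distrib := fun x y z => I.mulQ.map_add₂ x y z
    zero_mul := fun x => I.mulQ.map_zero₂ x
    mul_zero := fun x => (I.mulQ x).map_zero }

theorem proj_mul (I : AlgIdeal 𝔽 A) (a b : A) : I.proj (a * b) = I.proj a * I.proj b := rfl

instance (I : AlgIdeal 𝔽 A) : IsScalarTower 𝔽 I.Quotient I.Quotient where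
  smul_assoc := fun c x y => I.mulQ.map_smul₂ c x y

instance (I : AlgIdeal 𝔽 A) : SMulCommClass 𝔽 I.Quotient I.Quotient where
  smul_comm := fun c x y => ((I.mulQ x).map_smul c y).symm

instance [IsLeibniz A] (I : AlgIdeal 𝔽 A) : IsLeibniz I.Quotient where
  leibniz := fun x y z => by
    obtain ⟨a, rfl⟩ := I.proj_surjective x
    obtain ⟨b, rfl⟩ := I.proj_surjective y
    obtain ⟨c, rfl⟩ := I.proj_surjective z
    simp only [← proj_mul, ← map_add, IsLeibniz.leibniz a b c]

end AlgIdeal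

variable [IsScalarTower 𝔽 A A] [SMulCommClass 𝔽 A A]

variable (𝔽 A) in
/-- The center `Z(A) = {z | zx = xz = 0 for all x}`. -/
def center : Submodule 𝔽 A where
  carrier := {z | ∀ x : A, z * x = 0 ∧ x * z = 0}
  zero_mem' := fun x => by simp
  add_mem' := fun {a b} ha hb x => by
    simp [add_mul, mul_add, (ha x).1, (ha x).2, (hb x).1, (hb x).2]
  smul_mem' := fun c a ha x => by
    simp [smul_mul_assoc, mul_smul_comm, (ha x).1, (ha x).2]

/-- The product `ST`: the span of all `st` with `s ∈ S` and `t ∈ T`. -/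
def prod (S T : Submodule 𝔽 A) : Submodule 𝔽 A := Submodule.map₂ (LinearMap.mul 𝔽 A) S T

variable (𝔽 A) in
/-- The derived algebra `A' = AA`. -/
def derived : Submodule 𝔽 A := prod ⊤ ⊤

/-- `FR + RF` for a subspace `R` of `F`. -/
def comm (R : Submodule 𝔽 A) : Submodule 𝔽 A := prod ⊤ R ⊔ prod R ⊤

end Algebra

/-! ## Defining pairs, multipliers, and `Z*` -/

section Multiplier

variable (𝔽 : Type u) (L : Type v) [Field 𝔽] [NonUnitalNonAssocRing L] [Module 𝔽 L]
  [IsScalarTower 𝔽 L L] [SMulCommClass 𝔽 L L]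

/-- `(K, M)` is a defining pair for `L`: `L ≅ K / M` and `M ⊆ Z(K) ∩ K'`. -/
def IsDefiningPair {K : Type w} [NonUnitalNonAssocRing K] [Module 𝔽 K]
    [IsScalarTower 𝔽 K K] [SMulCommClass 𝔽 K K] (M : AlgIdeal 𝔽 K) : Prop :=
  (∃ e : M.Quotient →ₙₐ[𝔽] L, Function.Bijective e) ∧
    M.toSubmodule ≤ center 𝔽 K ⊓ derived 𝔽 K

/-- `(K, M)` is a defining pair for `L` for which the dimension of `K` is maximal. -/
def IsMaximalDefiningPair {K : Type w} [NonUnitalNonAssocRing K] [Module 𝔽 K]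
    [IsScalarTower 𝔽 K K] [SMulCommClass 𝔽 K K] (M : AlgIdeal 𝔽 K) : Prop :=
  IsDefiningPair 𝔽 L M ∧
    ∀ (K₁ : Type w) [NonUnitalNonAssocRing K₁] [Module 𝔽 K₁] [IsScalarTower 𝔽 K₁ K₁]
      [SMulCommClass 𝔽 K₁ K₁] [IsLeibniz K₁] (M₁ : AlgIdeal 𝔽 K₁),
      IsDefiningPair 𝔽 L M₁ → Module.rank 𝔽 K₁ ≤ Module.rank 𝔽 K

/-- `V` is (a copy of) the multiplier `M(L)`: it is isomorphic to `M` for some maximal defining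
pair `(K, M)` of `L`. Since `M` has zero multiplication, only its vector space structure counts. -/
def IsMultiplier (V : Type*) [AddCommGroup V] [Module 𝔽 V] : Prop :=
  ∃ (K : Type (max u v)) (_ : NonUnitalNonAssocRing K) (_ : Module 𝔽 K)
    (_ : IsScalarTower 𝔽 K K) (_ : SMulCommClass 𝔽 K K) (_ : IsLeibniz K) (M : AlgIdeal 𝔽 K),
    IsMaximalDefiningPair 𝔽 L M ∧ Nonempty (V ≃ₗ[𝔽] M.toSubmodule)

/-- `Z*(L)`: the intersection of the images `φ(Z(E))` over all central extensions
`0 → ker φ → E → L → 0` of Leibniz algebras. -/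
def zStar : Set L :=
  {x | ∀ (E : Type (max u v)) [NonUnitalNonAssocRing E] [Module 𝔽 E] [IsScalarTower 𝔽 E E]
    [SMulCommClass 𝔽 E E] [IsLeibniz E] (φ : E →ₙₐ[𝔽] L), Function.Surjective φ →
    ker φ ≤ center 𝔽 E → x ∈ φ '' (center 𝔽 E : Set E)}

end Multiplier

/-! ## Free Leibniz algebras and the natural map `β` -/

section Free

variable (𝔽 : Type u) [Field 𝔽]

/-- The ideal of the free nonassociative algebra generated by all `a(bc) - (ab)c - b(ac)`. -/
noncomputable def leibnizIdeal (X : Type w) : AlgIdeal 𝔽 (FreeNonUnitalNonAssocAlgebra 𝔽 X) :=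
  AlgIdeal.span 𝔽 {r | ∃ a b c : FreeNonUnitalNonAssocAlgebra 𝔽 X,
    r = a * (b * c) - ((a * b) * c + b * (a * c))}

/-- The free Leibniz algebra on `X`. -/
abbrev FreeLeibniz (X : Type w) : Type (max u w) := (leibnizIdeal 𝔽 X).Quotient

instance (X : Type w) : IsLeibniz (FreeLeibniz 𝔽 X) where
  leibniz := fun x y z => by
    obtain ⟨a, rfl⟩ := (leibnizIdeal 𝔽 X).proj_surjective x
    obtain ⟨b, rfl⟩ := (leibnizIdeal 𝔽 X).proj_surjective y
    obtain ⟨c, rfl⟩ := (leibnizIdeal 𝔽 X).proj_surjective z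
    simp only [← AlgIdeal.proj_mul, ← map_add]
    rw [← sub_eq_zero, ← map_sub, AlgIdeal.proj_eq_zero]
    exact AlgIdeal.subset_span _ ⟨a, b, c, rfl⟩

variable {𝔽} {F : Type v} [NonUnitalNonAssocRing F] [Module 𝔽 F]
  [IsScalarTower 𝔽 F F] [SMulCommClass 𝔽 F F]

/-- `(R ∩ F') / (FR + RF)`. -/
abbrev Hopf (R : Submodule 𝔽 F) : Type v :=
  ↥(R ⊓ derived 𝔽 F) ⧸ (comm R).submoduleOf (R ⊓ derived 𝔽 F)

theorem comm_mono {R T : Submodule 𝔽 F} (h : R ≤ T) : comm R ≤ comm T :=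
  sup_le_sup (Submodule.map₂_le_map₂_right h) (Submodule.map₂_le_map₂_left h)

/-- The natural map `β : (R ∩ F') / (FR + RF) → (T ∩ F') / (FT + TF)` induced by the inclusion
`R ∩ F' ⊆ T ∩ F'`, for `R ⊆ T ⊆ F`. -/
def beta {R T : Submodule 𝔽 F} (h : R ≤ T) : Hopf R →ₗ[𝔽] Hopf T :=
  Submodule.mapQ _ _ (Submodule.inclusion (inf_le_inf_right (derived 𝔽 F) h))
    (fun _ hx => comm_mono h hx)

end Free

/-! ## Second cohomology with coefficients in the field -/

section Cohomology

variable {𝔽 : Type u} {L : Type v} [Field 𝔽] [NonUnitalNonAssocRing L] [Module 𝔽 L]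

variable (𝔽 L) in
/-- 2-cocycles: bilinear forms `f` with `f(x, yz) = f(xy, z) + f(y, xz)`. -/
def Z2 : Submodule 𝔽 (L →ₗ[𝔽] L →ₗ[𝔽] 𝔽) where
  carrier := {f | ∀ x y z : L, f x (y * z) = f (x * y) z + f y (x * z)}
  zero_mem' := fun x y z => by simp
  add_mem' := fun {f g} hf hg x y z => by
    simp only [LinearMap.add_apply, hf x y z, hg x y z]
    abel
  smul_mem' := fun c f hf x y z => by
    simp only [LinearMap.smul_apply, hf x y z, smul_add]

variable (𝔽 L) in
/-- 2-coboundaries: bilinear forms `f` with `f(x, y) = -ε(xy)` for some linear `ε : L → 𝔽`. -/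
def B2 : Submodule 𝔽 (L →ₗ[𝔽] L →ₗ[𝔽] 𝔽) where
  carrier := {f | ∃ ε : L →ₗ[𝔽] 𝔽, ∀ x y : L, f x y = -ε (x * y)}
  zero_mem' := ⟨0, fun x y => by simp⟩
  add_mem' := by
    rintro f g ⟨ε, hf⟩ ⟨η, hg⟩
    exact ⟨ε + η, fun x y => by simp only [LinearMap.add_apply, hf, hg]; abel⟩
  smul_mem' := by
    rintro c f ⟨ε, hf⟩
    exact ⟨c • ε, fun x y => by simp only [LinearMap.smul_apply, hf, smul_neg]⟩

variable (𝔽 L) in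
/-- `H²(L, 𝔽) = Z²(L, 𝔽) / B²(L, 𝔽)`. -/
abbrev H2 : Type (max u v) := ↥(Z2 𝔽 L) ⧸ (B2 𝔽 L).submoduleOf (Z2 𝔽 L)

variable [IsScalarTower 𝔽 L L] [SMulCommClass 𝔽 L L]

theorem cocycle_left [IsLeibniz L] {f : L →ₗ[𝔽] L →ₗ[𝔽] 𝔽} (hf : f ∈ Z2 𝔽 L) {a z : L}
    (ha : a ∈ derived 𝔽 L) (hz : z ∈ center 𝔽 L) : f a z = 0 := by
  have h : derived 𝔽 L ≤ LinearMap.ker (f.flip z) := by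
    refine Submodule.map₂_le.2 fun x _ y _ => ?_
    have := hf x y z
    rw [(hz y).2, (hz x).2, map_zero, map_zero, add_zero] at this
    exact this.symm
  exact h ha

theorem cocycle_right [IsLeibniz L] {f : L →ₗ[𝔽] L →ₗ[𝔽] 𝔽} (hf : f ∈ Z2 𝔽 L) {a z : L}
    (ha : a ∈ derived 𝔽 L) (hz : z ∈ center 𝔽 L) : f z a = 0 := by
  have h : derived 𝔽 L ≤ LinearMap.ker (f z) := by
    refine Submodule.map₂_le.2 fun x _ y _ => ?_
    have := hf z x y
    rw [(hz x).1, (hz y).1, map_zero, map_zero, LinearMap.zero_apply, add_zero] at this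
    exact this
  exact h ha

/-- A cocycle `f` gives `f₁ : L/L' × Z → 𝔽`, `f₁(x + L', z) = f(x, z)`, and
`f₂ : Z × L/L' → 𝔽`, `f₂(z, x + L') = f(z, x)`. -/
def deltaPre [IsLeibniz L] (Z : Submodule 𝔽 L) (hZ : Z ≤ center 𝔽 L) :
    ↥(Z2 𝔽 L) →ₗ[𝔽]
      ((L ⧸ derived 𝔽 L) →ₗ[𝔽] ↥Z →ₗ[𝔽] 𝔽) × (↥Z →ₗ[𝔽] (L ⧸ derived 𝔽 L) →ₗ[𝔽] 𝔽) where
  toFun f :=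
    ((derived 𝔽 L).liftQ (f.1.domRestrict₂ Z)
        (fun _ ha => LinearMap.ext fun z => cocycle_left f.2 ha (hZ z.2)),
      LinearMap.flip ((derived 𝔽 L).liftQ (f.1.flip.domRestrict₂ Z)
        (fun _ ha => LinearMap.ext fun z => cocycle_right f.2 ha (hZ z.2))))
  map_add' f g := by
    refine Prod.ext ?_ ?_
    · apply Submodule.linearMap_qext
      rfl
    · refine LinearMap.ext fun z => ?_
      apply Submodule.linearMap_qext
      rfl
  map_smul' c f := by
    refine Prod.ext ?_ ?_
    · apply Submodule.linearMap_qext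
      rfl
    · refine LinearMap.ext fun z => ?_
      apply Submodule.linearMap_qext
      rfl

/-- The map `δ` from `H²(L, 𝔽)` to pairs of bilinear forms, for a subspace `Z ⊆ Z(L)`. -/
def deltaBil [IsLeibniz L] (Z : Submodule 𝔽 L) (hZ : Z ≤ center 𝔽 L) :
    H2 𝔽 L →ₗ[𝔽]
      ((L ⧸ derived 𝔽 L) →ₗ[𝔽] ↥Z →ₗ[𝔽] 𝔽) × (↥Z →ₗ[𝔽] (L ⧸ derived 𝔽 L) →ₗ[𝔽] 𝔽) :=
  Submodule.liftQ _ (deltaPre Z hZ) (by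
    rintro ⟨f, hf⟩ ⟨ε, hε⟩
    refine Prod.ext ?_ ?_
    · apply Submodule.linearMap_qext
      refine LinearMap.ext fun x => LinearMap.ext fun z => ?_
      change f x z = 0
      have h : f x z = -ε (x * z) := hε x z
      rw [h, (hZ z.2 x).2, map_zero, neg_zero]
    · refine LinearMap.ext fun z => ?_
      apply Submodule.linearMap_qext
      refine LinearMap.ext fun x => ?_
      change f z x = 0
      have h : f z x = -ε (z * x) := hε z x
      rw [h, (hZ z.2 x).1, map_zero, neg_zero])

/-- An identification `Bil(V × W, 𝔽) ≅ V ⊗ W` of finite-dimensional spaces (bilinear forms are the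
dual of `V ⊗ W`, which is identified with `V ⊗ W` through a basis). -/
noncomputable def bilEquivTensor (V W : Type*) [AddCommGroup V] [Module 𝔽 V] [AddCommGroup W]
    [Module 𝔽 W] [FiniteDimensional 𝔽 V] [FiniteDimensional 𝔽 W] :
    (V →ₗ[𝔽] W →ₗ[𝔽] 𝔽) ≃ₗ[𝔽] V ⊗[𝔽] W :=
  (TensorProduct.lift.equiv (RingHom.id 𝔽) V W 𝔽).trans
    (Module.finBasis 𝔽 (V ⊗[𝔽] W)).toDualEquiv.symm

/-- The map `δ : H²(L, 𝔽) → L/L' ⊗ Z ⊕ Z ⊗ L/L'`. -/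
noncomputable def delta [IsLeibniz L] [FiniteDimensional 𝔽 L] (Z : Submodule 𝔽 L)
    (hZ : Z ≤ center 𝔽 L) :
    H2 𝔽 L →ₗ[𝔽] ((L ⧸ derived 𝔽 L) ⊗[𝔽] ↥Z) × (↥Z ⊗[𝔽] (L ⧸ derived 𝔽 L)) :=
  (LinearEquiv.prodCongr (bilEquivTensor (L ⧸ derived 𝔽 L) ↥Z)
    (bilEquivTensor ↥Z (L ⧸ derived 𝔽 L))).toLinearMap.comp (deltaBil Z hZ)

/-- The factor set `f(x, y) = μ(x)μ(y) - μ(xy)` of a linear section `μ` of `L → L/Z`. -/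
def factorSet (Z : AlgIdeal 𝔽 L) (μ : Z.Quotient →ₗ[𝔽] L) (hμ : ∀ x, Z.proj (μ x) = x) :
    Z.Quotient →ₗ[𝔽] Z.Quotient →ₗ[𝔽] ↥Z.toSubmodule :=
  LinearMap.mk₂ 𝔽
    (fun x y => ⟨μ x * μ y - μ (x * y), by
      rw [← AlgIdeal.proj_eq_zero, map_sub, AlgIdeal.proj_mul, hμ, hμ, hμ, sub_self]⟩)
    (fun x y z => Subtype.ext (by
      simp only [map_add, add_mul, Submodule.coe_add]
      abel))
    (fun c x y => Subtype.ext (by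
      simp only [map_smul, smul_mul_assoc, Submodule.coe_smul, smul_sub]))
    (fun x y z => Subtype.ext (by
      simp only [map_add, mul_add, Submodule.coe_add]
      abel))
    (fun c x y => Subtype.ext (by
      simp only [map_smul, mul_smul_comm, Submodule.coe_smul, smul_sub]))

theorem factorSet_cocycle [IsLeibniz L] (Z : AlgIdeal 𝔽 L) (hZ : Z.toSubmodule ≤ center 𝔽 L)
    (μ : Z.Quotient →ₗ[𝔽] L) (hμ : ∀ x, Z.proj (μ x) = x) (χ : ↥Z.toSubmodule →ₗ[𝔽] 𝔽) :
    (factorSet Z μ hμ).compr₂ χ ∈ Z2 𝔽 Z.Quotient := by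
  intro x y z
  have hc (a b : Z.Quotient) : μ (a * b) = μ a * μ b - (factorSet Z μ hμ a b : L) := by
    change μ (a * b) = μ a * μ b - (μ a * μ b - μ (a * b))
    abel
  have hl (a b c : Z.Quotient) : (factorSet Z μ hμ a b : L) * μ c = 0 :=
    (hZ (factorSet Z μ hμ a b).2 _).1
  have hr (a b c : Z.Quotient) : μ c * (factorSet Z μ hμ a b : L) = 0 :=
    (hZ (factorSet Z μ hμ a b).2 _).2
  have key : factorSet Z μ hμ x (y * z) =
      factorSet Z μ hμ (x * y) z + factorSet Z μ hμ y (x * z) := by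
    apply Subtype.ext
    change μ x * μ (y * z) - μ (x * (y * z)) =
      (μ (x * y) * μ z - μ (x * y * z)) + (μ y * μ (x * z) - μ (y * (x * z)))
    rw [hc y z, hc x y, hc x z, mul_sub, sub_mul, mul_sub, hr, hl, hr,
      IsLeibniz.leibniz x y z, map_add, IsLeibniz.leibniz (μ x) (μ y) (μ z)]
    abel
  simp only [LinearMap.compr₂_apply, key, map_add]

theorem exists_section (Z : AlgIdeal 𝔽 L) :
    ∃ μ : Z.Quotient →ₗ[𝔽] L, ∀ x, Z.proj (μ x) = x := by
  obtain ⟨μ, h⟩ := Z.proj.exists_rightInverse_of_surjective (LinearMap.range_eq_top.2 Z.proj_surjective)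
  exact ⟨μ, fun x => LinearMap.congr_fun h x⟩

/-- The transgression map `Hom(Z, 𝔽) → H²(L/Z, 𝔽)`, `χ ↦ [χ ∘ f]`, where `f` is the factor set of a
linear section of `L → L/Z` (the class does not depend on the section). -/
noncomputable def transgression [IsLeibniz L] (Z : AlgIdeal 𝔽 L)
    (hZ : Z.toSubmodule ≤ center 𝔽 L) :
    (↥Z.toSubmodule →ₗ[𝔽] 𝔽) →ₗ[𝔽] H2 𝔽 Z.Quotient where
  toFun χ := Submodule.Quotient.mk
    ⟨(factorSet Z (exists_section Z).choose (exists_section Z).choose_spec).compr₂ χ,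
      factorSet_cocycle Z hZ _ _ χ⟩
  map_add' _ _ := rfl
  map_smul' _ _ := rfl

end Cohomology

end Leib

/-! Conditions 1, 2 and 4 are each equivalent to one statement (V): every 2-cocycle on `L` vanishes
on `L × Z` and on `Z × L`. For `δ` this is immediate. A cocycle pulled back to `F` becomes a
coboundary `-ε(xy)`, because a free algebra has no second cohomology, and the forms `ε` that arise
are exactly those killing `FR + RF`; so (V) says `FT + TF ⊆ FR + RF`, which is injectivity of `β`
(`cocycles_vanish_iff_comm_le`, `beta_injective_iff`). For `Z*`, a cocycle `f` is tested on the
extension `L × 𝔽` it defines, while in an arbitrary central extension products of lifts are detected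
by scalar cocycles (`subset_zStar_iff`).

Condition 3 comes from the exact sequence `Hom(Z, 𝔽) → H²(L/Z) → H²(L)`, continued by `δ`, with maps
transgression and inflation (`ker_inflation`, `range_inflation`): `δ = 0` means that inflation is
onto, and a dimension count recognises this from an abstract isomorphism.

The multiplier is computed by duality. For a central extension `K → L` with kernel `M`,
transgression identifies the dual of `M ∩ K'` with a subspace of `H²(L)` (`ker_tra`). This bounds
the dimension of a defining pair, and the extension by a universal cocycle with values in the dual
of `H²(L)` attains the bound. Similarly `H²(L)` is dual to `(R ∩ F')/(FR + RF)` (`ker_classOfDual`).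
-/

namespace Leib

open Module

/-! ## Central extensions defined by cocycles -/

section CentralExtension

variable {𝔽 : Type u} {L : Type v} [Field 𝔽] [NonUnitalNonAssocRing L] [Module 𝔽 L]
  {V : Type w} [AddCommGroup V] [Module 𝔽 V]

/-- The vector space `L × V` with the multiplication `(x, a)(y, b) = (xy, f(x, y))`. -/
def CentralExt (_f : L →ₗ[𝔽] L →ₗ[𝔽] V) : Type (max v w) := L × V

namespace CentralExt

variable (f : L →ₗ[𝔽] L →ₗ[𝔽] V)

instance : AddCommGroup (CentralExt f) := inferInstanceAs (AddCommGroup (L × V))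

instance : Module 𝔽 (CentralExt f) := inferInstanceAs (Module 𝔽 (L × V))

instance : NonUnitalNonAssocRing (CentralExt f) :=
  { (inferInstance : AddCommGroup (CentralExt f)) with
    mul := fun x y => (x.1 * y.1, f x.1 y.1)
    left_distrib := fun x y z => Prod.ext (mul_add x.1 y.1 z.1) (map_add (f x.1) y.1 z.1)
    right_distrib := fun x y z => Prod.ext (add_mul x.1 y.1 z.1) (f.map_add₂ x.1 y.1 z.1)
    zero_mul := fun x => Prod.ext (zero_mul x.1) (f.map_zero₂ x.1)
    mul_zero := fun x => Prod.ext (mul_zero x.1) (map_zero (f x.1)) }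

theorem mul_def (x y : CentralExt f) : x * y = ((x.1 * y.1, f x.1 y.1) : L × V) := rfl

instance [IsScalarTower 𝔽 L L] : IsScalarTower 𝔽 (CentralExt f) (CentralExt f) where
  smul_assoc c x y := Prod.ext (smul_mul_assoc c x.1 y.1) (f.map_smul₂ c x.1 y.1)

instance [SMulCommClass 𝔽 L L] : SMulCommClass 𝔽 (CentralExt f) (CentralExt f) where
  smul_comm c x y := Prod.ext (mul_smul_comm c x.1 y.1).symm (map_smul (f x.1) c y.1).symm

theorem isLeibniz [IsLeibniz L] (hf : ∀ x y z, f x (y * z) = f (x * y) z + f y (x * z)) :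
    IsLeibniz (CentralExt f) where
  leibniz x y z := Prod.ext (IsLeibniz.leibniz x.1 y.1 z.1) (hf x.1 y.1 z.1)

/-- The projection `L × V → L` as a homomorphism of algebras. -/
def fst : CentralExt f →ₙₐ[𝔽] L where
  toFun x := x.1
  map_smul' _ _ := rfl
  map_zero' := rfl
  map_add' _ _ := rfl
  map_mul' _ _ := rfl

/-- The projection `L × V → V`. -/
def snd : CentralExt f →ₗ[𝔽] V := LinearMap.snd 𝔽 L V

/-- The linear section `x ↦ (x, 0)`. -/
def inl : L →ₗ[𝔽] CentralExt f := LinearMap.inl 𝔽 L V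

/-- The inclusion `a ↦ (0, a)`. -/
def inr : V →ₗ[𝔽] CentralExt f := LinearMap.inr 𝔽 L V

theorem fst_surjective : Function.Surjective (fst f) := fun x => ⟨inl f x, rfl⟩

theorem mem_ker_fst {x : CentralExt f} (hx : x ∈ ker (fst f)) : x = inr f (snd f x) :=
  Prod.ext hx rfl

theorem ker_fst_le_center [IsScalarTower 𝔽 L L] [SMulCommClass 𝔽 L L] :
    ker (fst f) ≤ center 𝔽 (CentralExt f) := by
  intro z (hz : z.1 = 0) x
  constructor
  · rw [mul_def, hz, zero_mul, f.map_zero₂]; rfl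
  · rw [mul_def, hz, mul_zero, map_zero]; rfl

end CentralExt

end CentralExtension

/-! ## Kernels as ideals, and the isomorphism theorem -/

section Kernel

variable {𝔽 : Type u} {A : Type v} {B : Type w} [Field 𝔽] [NonUnitalNonAssocRing A] [Module 𝔽 A]
  [NonUnitalNonAssocRing B] [Module 𝔽 B]

/-- The kernel of a homomorphism as an ideal. -/
def kerIdeal (φ : A →ₙₐ[𝔽] B) : AlgIdeal 𝔽 A where
  toSubmodule := ker φ
  mul_mem_left a x hx := by
    change φ (a * x) = 0
    rw [map_mul, show φ x = 0 from hx, mul_zero]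
  mul_mem_right {x} a hx := by
    change φ (x * a) = 0
    rw [map_mul, show φ x = 0 from hx, zero_mul]

/-- The underlying linear map of a homomorphism. -/
abbrev lin (φ : A →ₙₐ[𝔽] B) : A →ₗ[𝔽] B := (φ : A →ₗ[𝔽] B)

theorem ker_lin (φ : A →ₙₐ[𝔽] B) : LinearMap.ker (lin φ) = ker φ := rfl

theorem exists_linear_section (φ : A →ₙₐ[𝔽] B) (hφ : Function.Surjective φ) :
    ∃ s : B →ₗ[𝔽] A, ∀ x, φ (s x) = x := by
  obtain ⟨s, h⟩ := (lin φ).exists_rightInverse_of_surjective (LinearMap.range_eq_top.2 hφ)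
  exact ⟨s, fun x => LinearMap.congr_fun h x⟩

variable [IsScalarTower 𝔽 A A] [SMulCommClass 𝔽 A A]

/-- The projection `A → A / I` as a homomorphism of algebras. -/
def projHom (I : AlgIdeal 𝔽 A) : A →ₙₐ[𝔽] I.Quotient :=
  { I.proj with
    map_zero' := map_zero I.proj
    map_mul' := I.proj_mul }

theorem ker_projHom (I : AlgIdeal 𝔽 A) : ker (projHom I) = I.toSubmodule :=
  Submodule.ext fun _ => I.proj_eq_zero

/-- A homomorphism that vanishes on an ideal factors through the quotient. -/
def quotientLift (I : AlgIdeal 𝔽 A) (φ : A →ₙₐ[𝔽] B) (h : I.toSubmodule ≤ ker φ) :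
    I.Quotient →ₙₐ[𝔽] B :=
  let g : I.Quotient →ₗ[𝔽] B := I.toSubmodule.liftQ (lin φ) h
  { g with
    map_zero' := map_zero g
    map_mul' := fun x y => by
      obtain ⟨a, rfl⟩ := I.proj_surjective x
      obtain ⟨b, rfl⟩ := I.proj_surjective y
      exact map_mul φ a b }

theorem exists_quotient_ker_bijective (φ : A →ₙₐ[𝔽] B) (hφ : Function.Surjective φ) :
    ∃ e : (kerIdeal φ).Quotient →ₙₐ[𝔽] B, Function.Bijective e := by
  refine ⟨quotientLift (kerIdeal φ) φ le_rfl, (injective_iff_map_eq_zero _).2 fun x hx => ?_,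
    fun b => ?_⟩
  · obtain ⟨a, rfl⟩ := (kerIdeal φ).proj_surjective x
    exact ((kerIdeal φ).proj_eq_zero).2 hx
  · obtain ⟨a, rfl⟩ := hφ b
    exact ⟨(kerIdeal φ).proj a, rfl⟩

theorem mul_mem_derived (x y : A) : x * y ∈ derived 𝔽 A :=
  Submodule.apply_mem_map₂ (LinearMap.mul 𝔽 A) Submodule.mem_top Submodule.mem_top

theorem derived_le_iff {S : Submodule 𝔽 A} : derived 𝔽 A ≤ S ↔ ∀ x y, x * y ∈ S :=
  Submodule.map₂_le.trans ⟨fun h x y => h x Submodule.mem_top y Submodule.mem_top,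
    fun h x _ y _ => h x y⟩

theorem comm_le_iff {R S : Submodule 𝔽 A} :
    comm R ≤ S ↔ ∀ x, ∀ r ∈ R, x * r ∈ S ∧ r * x ∈ S := by
  rw [comm, prod, prod, sup_le_iff, Submodule.map₂_le, Submodule.map₂_le]
  exact ⟨fun h x r hr => ⟨h.1 x Submodule.mem_top r hr, h.2 r hr x Submodule.mem_top⟩,
    fun h => ⟨fun x _ r hr => (h x r hr).1, fun r hr x _ => (h x r hr).2⟩⟩

theorem comm_le_derived (R : Submodule 𝔽 A) : comm R ≤ derived 𝔽 A :=
  comm_le_iff.2 fun x r _ => ⟨mul_mem_derived x r, mul_mem_derived r x⟩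

end Kernel

/-! ## The transgression of a central extension -/

section Forms

variable {𝔽 : Type u} {L : Type v} [Field 𝔽] [NonUnitalNonAssocRing L] [Module 𝔽 L]

theorem H2_mk_eq_zero {f : L →ₗ[𝔽] L →ₗ[𝔽] 𝔽} (hf : f ∈ Z2 𝔽 L) :
    (Submodule.Quotient.mk ⟨f, hf⟩ : H2 𝔽 L) = 0 ↔ ∃ ε : Dual 𝔽 L, ∀ x y, f x y = -ε (x * y) :=
  Submodule.Quotient.mk_eq_zero _

/-- A linear form that vanishes on `S ∩ T` agrees on `S` with a linear form that vanishes on `T`. -/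
theorem exists_form_eq_on_of_inf {E : Type*} [AddCommGroup E] [Module 𝔽 E] (S T : Submodule 𝔽 E)
    (χ : Dual 𝔽 E) (h : ∀ x ∈ S ⊓ T, χ x = 0) :
    ∃ g : Dual 𝔽 E, (∀ x ∈ S, g x = χ x) ∧ ∀ x ∈ T, g x = 0 := by
  have hm : χ ∘ₗ S.subtype ∈ (LinearMap.ker (T.mkQ ∘ₗ S.subtype)).dualAnnihilator := by
    rw [Submodule.mem_dualAnnihilator]
    intro x hx
    exact h x ⟨x.2, (Submodule.Quotient.mk_eq_zero T).1 hx⟩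
  rw [← LinearMap.range_dualMap_eq_dualAnnihilator_ker] at hm
  obtain ⟨g, hg⟩ := hm
  refine ⟨g ∘ₗ T.mkQ, fun x hx => LinearMap.congr_fun hg ⟨x, hx⟩, fun x hx => ?_⟩
  rw [LinearMap.comp_apply, T.mkQ_apply, (Submodule.Quotient.mk_eq_zero T).2 hx, map_zero]

end Forms

section Transgression

variable {𝔽 : Type u} {L : Type v} {K : Type w} [Field 𝔽] [NonUnitalNonAssocRing L] [Module 𝔽 L]
  [IsScalarTower 𝔽 L L] [SMulCommClass 𝔽 L L] [IsLeibniz L]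
  [NonUnitalNonAssocRing K] [Module 𝔽 K] [IsScalarTower 𝔽 K K] [SMulCommClass 𝔽 K K] [IsLeibniz K]

/-- The form `(x, y) ↦ χ(s(x)s(y) - s(xy))` for a linear section `s` of an extension `K → L` and a
linear form `χ` on `K`. -/
def factorForm (s : L →ₗ[𝔽] K) (χ : Dual 𝔽 K) : L →ₗ[𝔽] L →ₗ[𝔽] 𝔽 :=
  ((LinearMap.mul 𝔽 K).compl₁₂ s s - (LinearMap.mul 𝔽 L).compr₂ s).compr₂ χ

omit [IsLeibniz L] [IsLeibniz K] in
theorem factorForm_apply (s : L →ₗ[𝔽] K) (χ : Dual 𝔽 K) (x y : L) :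
    factorForm s χ x y = χ (s x * s y - s (x * y)) := rfl

variable (φ : K →ₙₐ[𝔽] L) (hφ : ker φ ≤ center 𝔽 K) (s : L →ₗ[𝔽] K) (hs : ∀ x, φ (s x) = x)

omit [IsScalarTower 𝔽 L L] [SMulCommClass 𝔽 L L] [IsLeibniz L] [IsScalarTower 𝔽 K K]
  [SMulCommClass 𝔽 K K] [IsLeibniz K] in
include hs in
theorem factor_mem_ker (x y : L) : s x * s y - s (x * y) ∈ ker φ := by
  change φ _ = 0
  rw [map_sub, map_mul, hs, hs, hs, sub_self]

omit [IsScalarTower 𝔽 L L] [SMulCommClass 𝔽 L L] [IsLeibniz L] [IsScalarTower 𝔽 K K]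
  [SMulCommClass 𝔽 K K] [IsLeibniz K] in
include hs in
theorem sub_section_mem_ker (k : K) : k - s (φ k) ∈ ker φ := by
  change φ _ = 0
  rw [map_sub, hs, sub_self]

-- Changing a factor by a central element does not change a product, so products in `K` are
-- determined by the images in `L`.
omit [IsScalarTower 𝔽 L L] [SMulCommClass 𝔽 L L] [IsLeibniz L] [IsLeibniz K] in
include hφ hs in
theorem section_mul_section (k l : K) : s (φ k) * s (φ l) = k * l := by
  have h1 := (hφ (sub_section_mem_ker φ s hs k) l).1
  have h2 := (hφ (sub_section_mem_ker φ s hs l) (s (φ k))).2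
  rw [sub_mul, sub_eq_zero] at h1
  rw [mul_sub, sub_eq_zero] at h2
  rw [← h2, h1]

-- Since `s(yz)` and `s(y)s(z)` differ by a central element, they are interchangeable inside a
-- product, and the Leibniz identity of `K` gives the cocycle identity.
include hφ hs in
theorem factorForm_mem_Z2 (χ : Dual 𝔽 K) : factorForm s χ ∈ Z2 𝔽 L := by
  intro x y z
  have h1 : s x * s (y * z) = s x * (s y * s z) := by
    have := (hφ (factor_mem_ker φ s hs y z) (s x)).2
    rw [mul_sub, sub_eq_zero] at this
    exact this.symm
  have h2 : s (x * y) * s z = s x * s y * s z := by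
    have := (hφ (factor_mem_ker φ s hs x y) (s z)).1
    rw [sub_mul, sub_eq_zero] at this
    exact this.symm
  have h3 : s y * s (x * z) = s y * (s x * s z) := by
    have := (hφ (factor_mem_ker φ s hs x z) (s y)).2
    rw [mul_sub, sub_eq_zero] at this
    exact this.symm
  simp only [factorForm_apply, ← map_add]
  congr 1
  rw [h1, h2, h3, IsLeibniz.leibniz (s x), IsLeibniz.leibniz x, map_add]
  abel

/-- The transgression `χ ↦ [χ(s(x)s(y) - s(xy))]` of a central extension `φ : K → L`. -/
def tra : Dual 𝔽 K →ₗ[𝔽] H2 𝔽 L where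
  toFun χ := Submodule.Quotient.mk ⟨factorForm s χ, factorForm_mem_Z2 φ hφ s hs χ⟩
  map_add' _ _ := rfl
  map_smul' _ _ := rfl

/-- A class depends only on `χ` restricted to `ker φ`, and it is trivial exactly when that
restriction can be continued by zero on `K'`. -/
theorem ker_tra :
    LinearMap.ker (tra φ hφ s hs) = (ker φ ⊓ derived 𝔽 K).dualAnnihilator := by
  ext χ
  rw [LinearMap.mem_ker, Submodule.mem_dualAnnihilator]
  refine (H2_mk_eq_zero _).trans ⟨?_, fun h => ?_⟩
  · rintro ⟨ε, hε⟩ m ⟨hm, hm'⟩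
    -- This form agrees with `χ` on `ker φ`, and the coboundary equation says that it kills all
    -- products.
    have h : derived 𝔽 K ≤ LinearMap.ker (χ - χ ∘ₗ s ∘ₗ lin φ + ε ∘ₗ lin φ) := by
      refine derived_le_iff.2 fun k l => ?_
      have h1 := hε (φ k) (φ l)
      rw [factorForm_apply, section_mul_section φ hφ s hs, ← map_mul, map_sub] at h1
      change χ (k * l) - χ (s (φ (k * l))) + ε (φ (k * l)) = 0
      rw [h1, neg_add_cancel]
    have h2 : χ m - χ (s (φ m)) + ε (φ m) = 0 := h hm'
    rwa [show φ m = 0 from hm, map_zero, map_zero, map_zero, sub_zero, add_zero] at h2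
  · obtain ⟨g, hg, hg'⟩ := exists_form_eq_on_of_inf (ker φ) (derived 𝔽 K) χ h
    -- Replacing `χ` by `g` does not change the form, and `g` kills `s(x)s(y)`; only `-g(s(xy))`
    -- remains.
    refine ⟨g ∘ₗ s, fun x y => ?_⟩
    rw [factorForm_apply, ← hg _ (factor_mem_ker φ s hs x y), map_sub, hg' _ (mul_mem_derived _ _),
      zero_sub]
    rfl

/-- The image of the transgression is dual to `ker φ ∩ K'`. -/
noncomputable def rangeTraEquiv :
    LinearMap.range (tra φ hφ s hs) ≃ₗ[𝔽] Dual 𝔽 ↥(ker φ ⊓ derived 𝔽 K) :=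
  (tra φ hφ s hs).quotKerEquivRange.symm.trans
    ((Submodule.quotEquivOfEq _ _ (ker_tra φ hφ s hs)).trans
      (Subspace.quotAnnihilatorEquiv (ker φ ⊓ derived 𝔽 K)))

end Transgression

/-! ## Existence and dimension of the multiplier -/

section Multiplier

variable {𝔽 : Type u} {L : Type v} [Field 𝔽] [NonUnitalNonAssocRing L] [Module 𝔽 L]
  [IsScalarTower 𝔽 L L] [SMulCommClass 𝔽 L L] [IsLeibniz L] [FiniteDimensional 𝔽 L]

theorem finrank_of_range_tra {K : Type w} [NonUnitalNonAssocRing K] [Module 𝔽 K]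
    [IsScalarTower 𝔽 K K] [SMulCommClass 𝔽 K K] [IsLeibniz K] (φ : K →ₙₐ[𝔽] L)
    (hφ : ker φ ≤ center 𝔽 K) (s : L →ₗ[𝔽] K) (hs : ∀ x, φ (s x) = x) :
    FiniteDimensional 𝔽 ↥(ker φ ⊓ derived 𝔽 K) ∧
      finrank 𝔽 ↥(ker φ ⊓ derived 𝔽 K) = finrank 𝔽 (LinearMap.range (tra φ hφ s hs)) := by
  have e := rangeTraEquiv φ hφ s hs
  have : FiniteDimensional 𝔽 (Dual 𝔽 ↥(ker φ ⊓ derived 𝔽 K)) := e.finiteDimensional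
  refine ⟨Module.finite_dual_iff 𝔽 |>.1 this, ?_⟩
  rw [e.finrank_eq, Subspace.dual_finrank_eq]

/-- Here `M ⊆ K'`, so `M` is all of `ker φ ∩ K'` and is dual to a subspace of `H²(L)`. -/
theorem IsDefiningPair.finite_and_finrank_le {K : Type w} [NonUnitalNonAssocRing K] [Module 𝔽 K]
    [IsScalarTower 𝔽 K K] [SMulCommClass 𝔽 K K] [IsLeibniz K] {M : AlgIdeal 𝔽 K}
    (h : IsDefiningPair 𝔽 L M) :
    FiniteDimensional 𝔽 K ∧ finrank 𝔽 K ≤ finrank 𝔽 L + finrank 𝔽 (H2 𝔽 L) := by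
  obtain ⟨⟨e, he⟩, hM⟩ := h
  let φ : K →ₙₐ[𝔽] L := e.comp (projHom M)
  have hφ : Function.Surjective φ := he.2.comp M.proj_surjective
  have hk : ker φ = M.toSubmodule := by
    rw [← ker_projHom]
    ext x
    exact map_eq_zero_iff e he.1
  obtain ⟨s, hs⟩ := exists_linear_section φ hφ
  have hc : ker φ ≤ center 𝔽 K := hk ▸ hM.trans inf_le_left
  obtain ⟨h1, h2⟩ := finrank_of_range_tra φ hc s hs
  rw [inf_eq_left.2 (hk ▸ hM.trans inf_le_right)] at h1 h2
  have hfin : FiniteDimensional 𝔽 K := by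
    have : FiniteDimensional 𝔽 (LinearMap.ker (lin φ)) := h1
    have : FiniteDimensional 𝔽 (K ⧸ LinearMap.ker (lin φ)) :=
      ((lin φ).quotKerEquivOfSurjective hφ).symm.finiteDimensional
    exact Module.Finite.of_submodule_quotient (LinearMap.ker (lin φ))
  refine ⟨hfin, ?_⟩
  rw [← (lin φ).finrank_range_add_finrank_ker, LinearMap.range_eq_top.2 hφ, finrank_top, ker_lin,
    h2]
  exact Nat.add_le_add_left (Submodule.finrank_le _) _

-- A linear choice `σ` of representatives of classes gives `f(x, y) = (h ↦ σ(h)(x, y))`; evaluating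
-- at `h` recovers `σ(h)`.
variable (𝔽 L) in
omit [IsScalarTower 𝔽 L L] [SMulCommClass 𝔽 L L] [IsLeibniz L] in
theorem exists_universal_cocycle :
    ∃ f : L →ₗ[𝔽] L →ₗ[𝔽] Dual 𝔽 (H2 𝔽 L),
      (∀ x y z, f x (y * z) = f (x * y) z + f y (x * z)) ∧
      ∀ h : H2 𝔽 L, ∃ hh : f.compr₂ (Dual.eval 𝔽 _ h) ∈ Z2 𝔽 L,
        Submodule.Quotient.mk ⟨_, hh⟩ = h := by
  obtain ⟨σ, hσ⟩ := ((B2 𝔽 L).submoduleOf (Z2 𝔽 L)).mkQ.exists_rightInverse_of_surjective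
    (LinearMap.range_eq_top.2 (Submodule.mkQ_surjective _))
  let f : L →ₗ[𝔽] L →ₗ[𝔽] Dual 𝔽 (H2 𝔽 L) :=
    LinearMap.mk₂ 𝔽 (fun x y => ((LinearMap.applyₗ y) ∘ₗ (LinearMap.applyₗ x)) ∘ₗ
      (Z2 𝔽 L).subtype ∘ₗ σ)
      (fun x y z => by ext; simp) (fun c x y => by ext; simp)
      (fun x y z => by ext; simp) (fun c x y => by ext; simp)
  refine ⟨f, fun x y z => LinearMap.ext fun h => (σ h).2 x y z, fun h => ⟨(σ h).2, ?_⟩⟩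
  exact LinearMap.congr_fun hσ h

variable (𝔽 L) in
theorem exists_maximalDefiningPair :
    ∃ (K : Type (max u v)) (_ : NonUnitalNonAssocRing K) (_ : Module 𝔽 K)
      (_ : IsScalarTower 𝔽 K K) (_ : SMulCommClass 𝔽 K K) (_ : IsLeibniz K) (M : AlgIdeal 𝔽 K),
      IsMaximalDefiningPair 𝔽 L M ∧ FiniteDimensional 𝔽 M.toSubmodule ∧
        finrank 𝔽 M.toSubmodule = finrank 𝔽 (H2 𝔽 L) := by
  obtain ⟨f, hf, hcls⟩ := exists_universal_cocycle 𝔽 L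
  have := CentralExt.isLeibniz f hf
  have hs : ∀ x, CentralExt.fst f (CentralExt.inl f x) = x := fun _ => rfl
  have hc := CentralExt.ker_fst_le_center f
  have hle : ker (CentralExt.fst f) ≤ derived 𝔽 (CentralExt f) := by
    -- A form `χ` killing `K'` has zero transgression. On the kernel, `χ` is evaluation at some `h`
    -- by reflexivity, and its transgression is `h`; so `h = 0` and `χ` kills the kernel too.
    by_contra hn
    obtain ⟨m, hm, hm'⟩ := SetLike.not_le_iff_exists.1 hn
    obtain ⟨χ, hχm, hχ⟩ := Submodule.exists_le_ker_of_notMem hm'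
    have hχ0 : tra _ hc _ hs χ = 0 := by
      rw [← LinearMap.mem_ker, ker_tra, Submodule.mem_dualAnnihilator]
      exact fun x hx => hχ hx.2
    obtain ⟨h, hh⟩ := (Module.bijective_dual_eval 𝔽 (H2 𝔽 L)).2 (χ ∘ₗ CentralExt.inr f)
    obtain ⟨hz, hzh⟩ := hcls h
    have hform : factorForm (CentralExt.inl f) χ = f.compr₂ (Dual.eval 𝔽 _ h) := by
      refine LinearMap.ext fun x => LinearMap.ext fun y => ?_
      rw [factorForm_apply, hh]
      refine congrArg χ (Prod.ext (sub_self (x * y)) (sub_zero (f x y)))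
    have h0 : h = 0 := by
      rw [← hzh, ← hχ0]
      exact congrArg Submodule.Quotient.mk (Subtype.ext hform.symm)
    apply hχm
    rw [CentralExt.mem_ker_fst f hm]
    change (χ ∘ₗ CentralExt.inr f) _ = 0
    rw [← hh, h0, map_zero, LinearMap.zero_apply]
  have hV : FiniteDimensional 𝔽 (CentralExt f) :=
    inferInstanceAs (FiniteDimensional 𝔽 (L × Dual 𝔽 (H2 𝔽 L)))
  have hrank : finrank 𝔽 (CentralExt f) = finrank 𝔽 L + finrank 𝔽 (H2 𝔽 L) := by
    rw [← Subspace.dual_finrank_eq (V := H2 𝔽 L)]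
    exact Module.finrank_prod
  refine ⟨CentralExt f, inferInstance, inferInstance, inferInstance, inferInstance, inferInstance,
    kerIdeal (CentralExt.fst f), ⟨⟨exists_quotient_ker_bijective _ (CentralExt.fst_surjective f),
      le_inf hc hle⟩, ?_⟩, inferInstance, ?_⟩
  · intro K₁ _ _ _ _ _ M₁ h
    obtain ⟨h1, h2⟩ := h.finite_and_finrank_le
    rw [← finrank_eq_rank, ← finrank_eq_rank, hrank]
    exact_mod_cast h2
  · have := (lin (CentralExt.fst f)).finrank_range_add_finrank_ker
    rw [LinearMap.range_eq_top.2 (CentralExt.fst_surjective f), finrank_top, hrank] at this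
    exact Nat.add_left_cancel this

/-- Only the vector space structure of a multiplier counts, so its dimension decides. -/
theorem isMultiplier_of_finrank_eq {V : Type*} [AddCommGroup V] [Module 𝔽 V]
    [FiniteDimensional 𝔽 V] (h : finrank 𝔽 V = finrank 𝔽 (H2 𝔽 L)) : IsMultiplier 𝔽 L V := by
  obtain ⟨K, i1, i2, i3, i4, i5, M, hM, hfin, hr⟩ := exists_maximalDefiningPair 𝔽 L
  exact ⟨K, i1, i2, i3, i4, i5, M, hM, ⟨LinearEquiv.ofFinrankEq _ _ (h.trans hr.symm)⟩⟩

end Multiplier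
/-! ## Free Leibniz algebras have trivial second cohomology -/

section Free

variable {𝔽 : Type u} [Field 𝔽]

theorem leibnizIdeal_le_ker {X : Type w} {A : Type v} [NonUnitalNonAssocRing A] [Module 𝔽 A]
    [IsLeibniz A] (φ : FreeNonUnitalNonAssocAlgebra 𝔽 X →ₙₐ[𝔽] A) :
    (leibnizIdeal 𝔽 X).toSubmodule ≤ ker φ := by
  intro r hr
  refine hr (kerIdeal φ) ?_
  rintro _ ⟨a, b, c, rfl⟩
  change φ _ = 0
  simp only [map_sub, map_add, map_mul]
  rw [IsLeibniz.leibniz (φ a), sub_self]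

/-- The extension of a map on generators to a free Leibniz algebra. -/
noncomputable def freeLift {X : Type w} {A : Type v} [NonUnitalNonAssocRing A] [Module 𝔽 A]
    [IsScalarTower 𝔽 A A] [SMulCommClass 𝔽 A A] [IsLeibniz A] (g : X → A) :
    FreeLeibniz 𝔽 X →ₙₐ[𝔽] A :=
  quotientLift (leibnizIdeal 𝔽 X) (FreeNonUnitalNonAssocAlgebra.lift 𝔽 g) (leibnizIdeal_le_ker _)

/-- By freeness the central extension defined by `f` splits, and the second component of a splitting
exhibits `f` as a coboundary. -/
theorem mem_B2_of_freeLeibniz {X : Type w} {f : FreeLeibniz 𝔽 X →ₗ[𝔽] FreeLeibniz 𝔽 X →ₗ[𝔽] 𝔽}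
    (hf : f ∈ Z2 𝔽 (FreeLeibniz 𝔽 X)) : f ∈ B2 𝔽 (FreeLeibniz 𝔽 X) := by
  have := CentralExt.isLeibniz f hf
  let p := projHom (leibnizIdeal 𝔽 X)
  let σ : FreeLeibniz 𝔽 X →ₙₐ[𝔽] CentralExt f :=
    freeLift fun x => CentralExt.inl f (p (FreeNonUnitalNonAssocAlgebra.of 𝔽 x))
  -- That `σ` is a section is checked on generators, after pulling back to the free nonassociative
  -- algebra.
  have hp : ((CentralExt.fst f).comp σ).comp p = p := by
    refine FreeNonUnitalNonAssocAlgebra.hom_ext 𝔽 fun x => ?_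
    change CentralExt.fst f (FreeNonUnitalNonAssocAlgebra.lift 𝔽 _ _) = _
    rw [FreeNonUnitalNonAssocAlgebra.lift_of_apply]
    rfl
  have hσ : ∀ x, (σ x).1 = x := by
    intro x
    obtain ⟨a, rfl⟩ := (leibnizIdeal 𝔽 X).proj_surjective x
    exact DFunLike.congr_fun hp a
  refine ⟨-(CentralExt.snd f ∘ₗ lin σ), fun x y => ?_⟩
  have h : (σ (x * y)).2 = f (σ x).1 (σ y).1 := by
    rw [map_mul]
    rfl
  rw [hσ, hσ] at h
  rw [LinearMap.neg_apply, neg_neg, ← h]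
  rfl

end Free

/-! ## Hopf's formula -/

section Hopf

variable {𝔽 : Type u} {L : Type v} {F : Type w} [Field 𝔽]
  [NonUnitalNonAssocRing L] [Module 𝔽 L]
  [NonUnitalNonAssocRing F] [Module 𝔽 F] [IsScalarTower 𝔽 F F] [SMulCommClass 𝔽 F F]

omit [IsScalarTower 𝔽 F F] [SMulCommClass 𝔽 F F] in
/-- Cocycles pull back to coboundaries along a homomorphism from an algebra without second
cohomology. -/
theorem exists_form_of_cocycle (hF : Z2 𝔽 F ≤ B2 𝔽 F) (π : F →ₙₐ[𝔽] L)
    {f : L →ₗ[𝔽] L →ₗ[𝔽] 𝔽} (hf : f ∈ Z2 𝔽 L) :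
    ∃ ε : Dual 𝔽 F, ∀ x y, f (π x) (π y) = -ε (x * y) := by
  have h : f.compl₁₂ (lin π) (lin π) ∈ Z2 𝔽 F := by
    intro x y z
    change f (π x) (π (y * z)) = f (π (x * y)) (π z) + f (π y) (π (x * z))
    rw [map_mul π, map_mul π, map_mul π]
    exact hf _ _ _
  exact hF h

theorem comm_ker_le_ker_of_form {π : F →ₙₐ[𝔽] L} {f : L →ₗ[𝔽] L →ₗ[𝔽] 𝔽} {ε : Dual 𝔽 F}
    (h : ∀ x y, f (π x) (π y) = -ε (x * y)) : comm (ker π) ≤ LinearMap.ker ε := by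
  refine comm_le_iff.2 fun x r (hr : π r = 0) => ⟨?_, ?_⟩
  · rw [LinearMap.mem_ker, ← neg_eq_zero, ← h, hr, map_zero]
  · rw [LinearMap.mem_ker, ← neg_eq_zero, ← h, hr, f.map_zero₂]

section Section

variable (π : F →ₙₐ[𝔽] L) (s : L →ₗ[𝔽] F)

/-- The form `(x, y) ↦ -ε(s(x)s(y))` for a linear section `s` of `π : F → L` and a linear form `ε`
on `F / (FR + RF)`, where `R = ker π`. -/
def formOfDual (ε : Dual 𝔽 (F ⧸ comm (ker π))) : L →ₗ[𝔽] L →ₗ[𝔽] 𝔽 :=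
  -((LinearMap.mul 𝔽 F).compl₁₂ s s).compr₂ (ε ∘ₗ (comm (ker π)).mkQ)

variable {π s} (hs : ∀ x, π (s x) = x)

-- Replacing `s(π x)` by `x` changes products only by elements of `FR + RF`.
include hs in
theorem formOfDual_apply (ε : Dual 𝔽 (F ⧸ comm (ker π))) (x y : F) :
    formOfDual π s ε (π x) (π y) = -ε ((comm (ker π)).mkQ (x * y)) := by
  change -ε ((comm (ker π)).mkQ (s (π x) * s (π y))) = _
  congr 2
  refine (Submodule.Quotient.eq _).2 ?_
  have h : s (π x) * s (π y) - x * y = (s (π x) - x) * s (π y) + x * (s (π y) - y) := by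
    rw [sub_mul, mul_sub]
    abel
  have hk : ∀ z, s (π z) - z ∈ ker π := fun z => by
    change π _ = 0
    rw [map_sub, hs, sub_self]
  rw [h]
  exact Submodule.add_mem _ (comm_le_iff.1 le_rfl _ _ (hk x)).2 (comm_le_iff.1 le_rfl _ _ (hk y)).1

include hs in
theorem formOfDual_mem_Z2 [IsLeibniz F] (ε : Dual 𝔽 (F ⧸ comm (ker π))) :
    formOfDual π s ε ∈ Z2 𝔽 L := by
  intro x y z
  rw [← hs x, ← hs y, ← hs z]
  simp only [← map_mul]
  simp only [formOfDual_apply hs]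
  rw [IsLeibniz.leibniz (s x), map_add, map_add, neg_add]

/-- The map `ε ↦ [(x, y) ↦ -ε(s(x)s(y))]` onto the second cohomology. -/
def classOfDual [IsLeibniz F] : Dual 𝔽 (F ⧸ comm (ker π)) →ₗ[𝔽] H2 𝔽 L where
  toFun ε := Submodule.Quotient.mk ⟨formOfDual π s ε, formOfDual_mem_Z2 hs ε⟩
  map_add' _ _ := congrArg Submodule.Quotient.mk (Subtype.ext (LinearMap.ext fun _ =>
    LinearMap.ext fun _ => neg_add _ _))
  map_smul' c _ := congrArg Submodule.Quotient.mk (Subtype.ext (LinearMap.ext fun _ =>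
    LinearMap.ext fun _ => (mul_neg c _).symm))

theorem classOfDual_surjective [IsLeibniz F] (hF : Z2 𝔽 F ≤ B2 𝔽 F) :
    Function.Surjective (classOfDual hs) := by
  intro c
  obtain ⟨⟨f, hf⟩, rfl⟩ := Submodule.mkQ_surjective _ c
  obtain ⟨ε, hε⟩ := exists_form_of_cocycle hF π hf
  refine ⟨(comm (ker π)).liftQ ε (comm_ker_le_ker_of_form hε),
    congrArg Submodule.Quotient.mk (Subtype.ext ?_)⟩
  refine LinearMap.ext fun x => LinearMap.ext fun y => ?_
  change formOfDual π s _ x y = f x y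
  rw [← hs x, ← hs y, formOfDual_apply hs, hε]
  rfl

end Section

/-- The inclusion of `(R ∩ F') / (FR + RF)` into `F / (FR + RF)`. -/
def hopfInclusion (R : Submodule 𝔽 F) : Hopf R →ₗ[𝔽] F ⧸ comm R :=
  Submodule.mapQ _ _ (R ⊓ derived 𝔽 F).subtype le_rfl

theorem hopfInclusion_injective (R : Submodule 𝔽 F) : Function.Injective (hopfInclusion R) := by
  refine (injective_iff_map_eq_zero _).2 fun x hx => ?_
  obtain ⟨a, rfl⟩ := Submodule.mkQ_surjective _ x
  exact (Submodule.Quotient.mk_eq_zero _).2 ((Submodule.Quotient.mk_eq_zero (comm R)).1 hx)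

/-- With surjectivity of `classOfDual`, this presents `H²(L)` as the dual of `F/(FR + RF)` modulo
the forms vanishing on `(R ∩ F')/(FR + RF)`, that is, as the dual of the latter. -/
theorem ker_classOfDual [IsLeibniz F] {π : F →ₙₐ[𝔽] L} {s : L →ₗ[𝔽] F} (hs : ∀ x, π (s x) = x) :
    LinearMap.ker (classOfDual hs) = LinearMap.ker (hopfInclusion (ker π)).dualMap := by
  ext ε
  let q : F →ₗ[𝔽] F ⧸ comm (ker π) := (comm (ker π)).mkQ
  have key : ε ∈ LinearMap.ker (hopfInclusion (ker π)).dualMap ↔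
      ∀ r ∈ ker π ⊓ derived 𝔽 F, ε (q r) = 0 := by
    constructor
    · intro h r hr
      exact LinearMap.congr_fun h (Submodule.Quotient.mk ⟨r, hr⟩)
    · intro h
      refine LinearMap.ext fun a => ?_
      obtain ⟨a, rfl⟩ := Submodule.mkQ_surjective _ a
      exact h a a.2
  rw [key]
  refine (H2_mk_eq_zero _).trans ⟨?_, fun h => ?_⟩
  · rintro ⟨η, hη⟩ r ⟨hr, hr'⟩
    have h : derived 𝔽 F ≤ LinearMap.ker (ε ∘ₗ q - η ∘ₗ lin π) := by
      refine derived_le_iff.2 fun x y => ?_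
      have h1 := hη (π x) (π y)
      rw [formOfDual_apply hs, neg_inj, ← map_mul] at h1
      exact sub_eq_zero.2 h1
    have h2 : ε (q r) - η (π r) = 0 := h hr'
    rwa [show π r = 0 from hr, map_zero, sub_zero] at h2
  -- Vanishing on `R ∩ F'` yields a form `g` equal to `ε ∘ q` on products and zero on `R`; it
  -- descends to `L` as `g ∘ s`.
  · obtain ⟨g, hg, hg'⟩ := exists_form_eq_on_of_inf (derived 𝔽 F) (ker π) (ε ∘ₗ q)
      fun x hx => h x hx.symm
    refine ⟨g ∘ₗ s, fun x y => ?_⟩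
    have hd : g (s (x * y) - s x * s y) = 0 := by
      refine hg' _ ?_
      change π _ = 0
      rw [map_sub, map_mul π, hs, hs, hs, sub_self]
    rw [map_sub, sub_eq_zero, hg _ (mul_mem_derived _ _)] at hd
    rw [LinearMap.comp_apply, hd]
    rfl

theorem finite_and_finrank_hopf [IsLeibniz F] [FiniteDimensional 𝔽 L] (hF : Z2 𝔽 F ≤ B2 𝔽 F)
    (π : F →ₙₐ[𝔽] L) (hπ : Function.Surjective π) :
    FiniteDimensional 𝔽 (Hopf (ker π)) ∧ finrank 𝔽 (Hopf (ker π)) = finrank 𝔽 (H2 𝔽 L) := by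
  obtain ⟨s, hs⟩ := exists_linear_section π hπ
  have e : H2 𝔽 L ≃ₗ[𝔽] Dual 𝔽 (Hopf (ker π)) :=
    ((classOfDual hs).quotKerEquivOfSurjective (classOfDual_surjective hs hF)).symm.trans
      ((Submodule.quotEquivOfEq _ _ (ker_classOfDual hs)).trans
        ((hopfInclusion (ker π)).dualMap.quotKerEquivOfSurjective
          (LinearMap.dualMap_surjective_of_injective (hopfInclusion_injective _))))
  have : FiniteDimensional 𝔽 (Dual 𝔽 (Hopf (ker π))) := e.finiteDimensional
  refine ⟨Module.finite_dual_iff 𝔽 |>.1 this, ?_⟩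
  rw [e.finrank_eq, Subspace.dual_finrank_eq]

/-- The natural map `β` is injective exactly when `FT + TF ⊆ FR + RF`, for `R = ker π` and `T` the
preimage of a central subspace. -/
theorem beta_injective_iff [IsScalarTower 𝔽 L L] [SMulCommClass 𝔽 L L] (π : F →ₙₐ[𝔽] L)
    {Z : Submodule 𝔽 L} (hZ : Z ≤ center 𝔽 L) :
    Function.Injective (beta (ker_le_preimage π Z)) ↔ comm (preimage π Z) ≤ comm (ker π) := by
  -- As `Z` is central, `FT + TF ⊆ R`, so each of its elements represents a class in the source of
  -- `β`, killed by `β`.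
  have hc : comm (preimage π Z) ≤ ker π := comm_le_iff.2 fun x t ht => by
    constructor
    · change π _ = 0
      rw [map_mul, (hZ ht _).2]
    · change π _ = 0
      rw [map_mul, (hZ ht _).1]
  rw [injective_iff_map_eq_zero]
  constructor
  · intro h x hx
    have h1 := h (Submodule.Quotient.mk ⟨x, hc hx, comm_le_derived _ hx⟩)
      ((Submodule.Quotient.mk_eq_zero _).2 hx)
    exact (Submodule.Quotient.mk_eq_zero ((comm (ker π)).submoduleOf _)).1 h1
  · intro h a ha
    obtain ⟨a, rfl⟩ := Submodule.mkQ_surjective _ a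
    exact (Submodule.Quotient.mk_eq_zero _).2 (h ((Submodule.Quotient.mk_eq_zero
      ((comm (preimage π Z)).submoduleOf (preimage π Z ⊓ derived 𝔽 F))).1 ha))

/-- Every cocycle vanishes on `L × Z` and `Z × L` if and only if `FT + TF ⊆ FR + RF`. -/
theorem cocycles_vanish_iff_comm_le [IsLeibniz F] (hF : Z2 𝔽 F ≤ B2 𝔽 F) (π : F →ₙₐ[𝔽] L)
    (hπ : Function.Surjective π) (Z : Submodule 𝔽 L) :
    (∀ f ∈ Z2 𝔽 L, ∀ x, ∀ z ∈ Z, f x z = 0 ∧ f z x = 0) ↔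
      comm (preimage π Z) ≤ comm (ker π) := by
  obtain ⟨s, hs⟩ := exists_linear_section π hπ
  constructor
  · intro h a ha
    -- A form `ε` that kills `FR + RF` but not `a` comes from a cocycle on `L`, which by hypothesis
    -- forces `ε` to kill `FT + TF`.
    by_contra hn
    obtain ⟨ε, hεa, hε⟩ := Submodule.exists_le_ker_of_notMem hn
    refine hεa ((?_ : comm (preimage π Z) ≤ LinearMap.ker ε) ha)
    let η : Dual 𝔽 (F ⧸ comm (ker π)) := (comm (ker π)).liftQ ε hε
    have hη : ∀ x y, formOfDual π s η (π x) (π y) = -ε (x * y) := formOfDual_apply hs η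
    refine comm_le_iff.2 fun x t ht => ?_
    have h1 := h _ (formOfDual_mem_Z2 hs η) (π x) (π t) ht
    rw [hη, hη, neg_eq_zero, neg_eq_zero] at h1
    exact h1
  · intro h f hf x z hz
    obtain ⟨ε, hε⟩ := exists_form_of_cocycle hF π hf
    have h1 := comm_le_iff.1 (h.trans (comm_ker_le_ker_of_form hε)) (s x) (s z)
      (show π (s z) ∈ Z by rwa [hs])
    rw [← hs x, ← hs z, hε, hε, neg_eq_zero, neg_eq_zero]
    exact h1

end Hopf

/-! ## Inflation -/

section Inflation

variable {𝔽 : Type u} {L : Type v} [Field 𝔽] [NonUnitalNonAssocRing L] [Module 𝔽 L]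
  [IsScalarTower 𝔽 L L] [SMulCommClass 𝔽 L L]

/-- The inflation map `H²(L/Z, 𝔽) → H²(L, 𝔽)`. -/
def inflation (Z : AlgIdeal 𝔽 L) : H2 𝔽 Z.Quotient →ₗ[𝔽] H2 𝔽 L :=
  Submodule.mapQ _ _
    (LinearMap.codRestrict (Z2 𝔽 L)
      ({ toFun := fun f => f.1.compl₁₂ Z.proj Z.proj
         map_add' := fun _ _ => rfl
         map_smul' := fun _ _ => rfl } : Z2 𝔽 Z.Quotient →ₗ[𝔽] L →ₗ[𝔽] L →ₗ[𝔽] 𝔽)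
      fun f x y z => f.2 (Z.proj x) (Z.proj y) (Z.proj z))
    (by
      rintro ⟨f, hf⟩ ⟨ε, hε⟩
      exact ⟨ε ∘ₗ Z.proj, fun x y => hε (Z.proj x) (Z.proj y)⟩)

variable [IsLeibniz L]

theorem deltaBil_mk_eq_zero_iff (Z : Submodule 𝔽 L) (hZ : Z ≤ center 𝔽 L) (f : Z2 𝔽 L) :
    deltaBil Z hZ (Submodule.Quotient.mk f) = 0 ↔ ∀ x, ∀ z ∈ Z, f.1 x z = 0 ∧ f.1 z x = 0 := by
  constructor
  · intro h x z hz
    exact ⟨LinearMap.congr_fun (LinearMap.congr_fun (congrArg Prod.fst h) (Submodule.Quotient.mk x))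
        ⟨z, hz⟩,
      LinearMap.congr_fun (LinearMap.congr_fun (congrArg Prod.snd h) ⟨z, hz⟩)
        (Submodule.Quotient.mk x)⟩
  · intro h
    refine Prod.ext ?_ ?_
    · apply Submodule.linearMap_qext
      exact LinearMap.ext fun x => LinearMap.ext fun z => (h x z z.2).1
    · refine LinearMap.ext fun z => ?_
      apply Submodule.linearMap_qext
      exact LinearMap.ext fun x => (h x z z.2).2

theorem deltaBil_eq_zero_iff (Z : Submodule 𝔽 L) (hZ : Z ≤ center 𝔽 L) :
    deltaBil Z hZ = 0 ↔ ∀ f ∈ Z2 𝔽 L, ∀ x, ∀ z ∈ Z, f x z = 0 ∧ f z x = 0 := by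
  constructor
  · intro h f hf
    refine (deltaBil_mk_eq_zero_iff Z hZ ⟨f, hf⟩).1 ?_
    rw [h, LinearMap.zero_apply]
  · intro h
    refine LinearMap.ext fun c => ?_
    obtain ⟨f, rfl⟩ := Submodule.mkQ_surjective _ c
    exact (deltaBil_mk_eq_zero_iff Z hZ f).2 (h f.1 f.2)

theorem delta_eq_zero_iff [FiniteDimensional 𝔽 L] (Z : Submodule 𝔽 L) (hZ : Z ≤ center 𝔽 L) :
    delta Z hZ = 0 ↔ deltaBil Z hZ = 0 := by
  constructor
  · intro h
    refine LinearMap.ext fun c => ?_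
    exact (LinearEquiv.prodCongr (bilEquivTensor (L ⧸ derived 𝔽 L) ↥Z)
      (bilEquivTensor ↥Z (L ⧸ derived 𝔽 L))).map_eq_zero_iff.1 (LinearMap.congr_fun h c)
  · intro h
    rw [delta, h, LinearMap.comp_zero]

/-- Exactness at `H²(L)`: a cocycle vanishing whenever an argument lies in `Z` depends only on
classes modulo `Z`, so it descends through a section. -/
theorem range_inflation (Z : AlgIdeal 𝔽 L) (hZ : Z.toSubmodule ≤ center 𝔽 L) :
    LinearMap.range (inflation Z) = LinearMap.ker (deltaBil Z.toSubmodule hZ) := by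
  obtain ⟨μ, hμ⟩ := exists_section Z
  apply le_antisymm
  · rintro _ ⟨c, rfl⟩
    obtain ⟨f, rfl⟩ := Submodule.mkQ_surjective _ c
    refine (deltaBil_mk_eq_zero_iff _ hZ _).2 fun x z hz => ?_
    change f.1 (Z.proj x) (Z.proj z) = 0 ∧ f.1 (Z.proj z) (Z.proj x) = 0
    rw [(Z.proj_eq_zero).2 hz, map_zero, f.1.map_zero₂]
    exact ⟨rfl, rfl⟩
  · intro c hc
    obtain ⟨⟨f, hf⟩, rfl⟩ := Submodule.mkQ_surjective _ c
    have hfZ : ∀ x, ∀ z ∈ Z.toSubmodule, f x z = 0 ∧ f z x = 0 :=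
      (deltaBil_mk_eq_zero_iff _ hZ _).1 hc
    have hsub : ∀ x, μ (Z.proj x) - x ∈ Z.toSubmodule := fun x => by
      rw [← Z.proj_eq_zero, map_sub, hμ, sub_self]
    have hfμ : ∀ x y, f (μ (Z.proj x)) (μ (Z.proj y)) = f x y := by
      intro x y
      have h1 := (hfZ (μ (Z.proj y)) _ (hsub x)).2
      have h2 := (hfZ x _ (hsub y)).1
      rw [map_sub, LinearMap.sub_apply, sub_eq_zero] at h1
      rw [map_sub, sub_eq_zero] at h2
      rw [h1, h2]
    refine ⟨Submodule.Quotient.mk ⟨f.compl₁₂ μ μ, ?_⟩,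
      congrArg Submodule.Quotient.mk (Subtype.ext (LinearMap.ext fun x => LinearMap.ext (hfμ x)))⟩
    intro x y z
    obtain ⟨x, rfl⟩ := Z.proj_surjective x
    obtain ⟨y, rfl⟩ := Z.proj_surjective y
    obtain ⟨z, rfl⟩ := Z.proj_surjective z
    simp only [← AlgIdeal.proj_mul, LinearMap.compl₁₂_apply, hfμ]
    exact hf x y z

/-- Forms on `Z` extend to `L`, so transgressing from either dual gives the same image. -/
theorem exists_range_transgression_eq (Z : AlgIdeal 𝔽 L) (hZ : Z.toSubmodule ≤ center 𝔽 L) :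
    ∃ (μ : Z.Quotient →ₗ[𝔽] L) (hμ : ∀ x, projHom Z (μ x) = x),
      LinearMap.range (transgression Z hZ) =
        LinearMap.range (tra (projHom Z) ((ker_projHom Z).trans_le hZ) μ hμ) := by
  refine ⟨(exists_section Z).choose, (exists_section Z).choose_spec, le_antisymm ?_ ?_⟩
  · rintro _ ⟨χ, rfl⟩
    obtain ⟨g, rfl⟩ := LinearMap.exists_extend χ
    exact ⟨g, rfl⟩
  · rintro _ ⟨χ, rfl⟩
    exact ⟨χ ∘ₗ Z.toSubmodule.subtype, rfl⟩

/-- Exactness at `H²(L/Z)`: if `f` inflates to `-ε(xy)`, then `[f]` is the transgression of `-ε`,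
the correction being the coboundary of `-(ε ∘ μ)`. -/
theorem ker_inflation (Z : AlgIdeal 𝔽 L) (hZ : Z.toSubmodule ≤ center 𝔽 L) :
    LinearMap.ker (inflation Z) = LinearMap.range (transgression Z hZ) := by
  obtain ⟨μ, hs, hr⟩ := exists_range_transgression_eq Z hZ
  have hmul := section_mul_section (projHom Z) ((ker_projHom Z).trans_le hZ) μ hs
  rw [hr]
  apply le_antisymm
  · intro c hc
    obtain ⟨⟨f, hf⟩, rfl⟩ := Submodule.mkQ_surjective _ c
    obtain ⟨ε, hε⟩ := (H2_mk_eq_zero _).1 hc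
    replace hε : ∀ x y, f (Z.proj x) (Z.proj y) = -ε (x * y) := hε
    refine ⟨-ε, (Submodule.Quotient.eq _).2 ⟨-(ε ∘ₗ μ), fun x y => ?_⟩⟩
    have h := hε (μ x) (μ y)
    rw [show Z.proj (μ x) = x from hs x, show Z.proj (μ y) = y from hs y] at h
    change (-ε) (μ x * μ y - μ (x * y)) - f x y = -(-ε (μ (x * y)))
    rw [h, LinearMap.neg_apply, map_sub]
    abel
  · rintro _ ⟨χ, rfl⟩
    refine (H2_mk_eq_zero _).2 ⟨-χ + χ ∘ₗ μ ∘ₗ Z.proj, fun x y => ?_⟩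
    change χ (μ (projHom Z x) * μ (projHom Z y) - μ (Z.proj (x * y))) =
      -(-χ (x * y) + χ (μ (Z.proj (x * y))))
    rw [hmul, map_sub]
    abel

end Inflation

/-! ## The epicenter -/

section Epicenter

variable {𝔽 : Type u} {L : Type v} [Field 𝔽] [NonUnitalNonAssocRing L] [Module 𝔽 L]
  [IsScalarTower 𝔽 L L] [SMulCommClass 𝔽 L L] [IsLeibniz L]

theorem subset_zStar_iff (Z : Submodule 𝔽 L) (hZ : Z ≤ center 𝔽 L) :
    (Z : Set L) ⊆ zStar 𝔽 L ↔ ∀ f ∈ Z2 𝔽 L, ∀ x, ∀ z ∈ Z, f x z = 0 ∧ f z x = 0 := by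
  constructor
  · intro h f hf x z hz
    have := CentralExt.isLeibniz f hf
    obtain ⟨e, he, rfl⟩ := h hz (CentralExt f) (CentralExt.fst f) (CentralExt.fst_surjective f)
      (CentralExt.ker_fst_le_center f)
    -- The second components of the products of the central lift `e` with `(x, 0)` are the values of
    -- `f`.
    have h1 := he (CentralExt.inl f x)
    exact ⟨congrArg Prod.snd h1.2, congrArg Prod.snd h1.1⟩
  · intro h z hz E _ _ _ _ _ φ hφ hc
    obtain ⟨s, hs⟩ := exists_linear_section φ hφ
    -- Because `zx = xz = 0`, the factor form of `χ` at these arguments is `χ` of the product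
    -- itself, and linear forms separate points.
    have key : ∀ x, s z * s x = 0 ∧ s x * s z = 0 := by
      intro x
      constructor <;> refine (Module.forall_dual_apply_eq_zero_iff 𝔽 _).1 fun χ => ?_
      · have h1 := (h _ (factorForm_mem_Z2 φ hc s hs χ) x z hz).2
        rwa [factorForm_apply, (hZ hz x).1, map_zero, sub_zero] at h1
      · have h1 := (h _ (factorForm_mem_Z2 φ hc s hs χ) x z hz).1
        rwa [factorForm_apply, (hZ hz x).2, map_zero, sub_zero] at h1
    refine ⟨s z, fun e => ?_, hs z⟩
    have hm := section_mul_section φ hc s hs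
    rw [← hm (s z) e, ← hm e (s z), hs]
    exact key (φ e)

end Epicenter

end Leib

/-! ### The multipliers and the four equivalent conditions -/

theorem mainTheorem1 {𝔽 : Type u} {L : Type v} [Field 𝔽] [NonUnitalNonAssocRing L] [Module 𝔽 L]
    [IsScalarTower 𝔽 L L] [SMulCommClass 𝔽 L L] [Leib.IsLeibniz L] [FiniteDimensional 𝔽 L]
    (Z : Leib.AlgIdeal 𝔽 L) (hZ : Z.toSubmodule ≤ Leib.center 𝔽 L)
    {X : Type w} (π : Leib.FreeLeibniz 𝔽 X →ₙₐ[𝔽] L) (hπ : Function.Surjective π) :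
    ((Leib.IsMultiplier 𝔽 L (Leib.H2 𝔽 L) ∧ Leib.IsMultiplier 𝔽 L (Leib.Hopf (Leib.ker π))) ∧
      (Leib.IsMultiplier 𝔽 Z.Quotient (Leib.H2 𝔽 Z.Quotient) ∧
        Leib.IsMultiplier 𝔽 Z.Quotient (Leib.Hopf (Leib.preimage π Z.toSubmodule)))) ∧
    List.TFAE [
      Leib.delta Z.toSubmodule hZ = 0,
      Function.Injective (Leib.beta (Leib.ker_le_preimage π Z.toSubmodule)),
      ∃ j : ↥(Leib.derived 𝔽 L ⊓ Z.toSubmodule) →ₗ[𝔽] Leib.H2 𝔽 Z.Quotient,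
        Function.Injective j ∧
        LinearMap.range j = LinearMap.range (Leib.transgression Z hZ) ∧
        Nonempty (Leib.H2 𝔽 L ≃ₗ[𝔽] (Leib.H2 𝔽 Z.Quotient ⧸ LinearMap.range j)),
      (Z.toSubmodule : Set L) ⊆ Leib.zStar 𝔽 L] := by
  have hF : Leib.Z2 𝔽 (Leib.FreeLeibniz 𝔽 X) ≤ Leib.B2 𝔽 (Leib.FreeLeibniz 𝔽 X) :=
    fun _ hf => Leib.mem_B2_of_freeLeibniz hf
  have hfin : FiniteDimensional 𝔽 Z.Quotient := Module.Finite.of_surjective Z.proj Z.proj_surjective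
  constructor
  · have h1 := Leib.finite_and_finrank_hopf hF π hπ
    have h2 := Leib.finite_and_finrank_hopf hF ((Leib.projHom Z).comp π)
      (Z.proj_surjective.comp hπ)
    -- `T` is the kernel of `F → L/Z`, so Hopf's formula applies to `L/Z` with `T` in place of `R`.
    have hk : Leib.ker ((Leib.projHom Z).comp π) = Leib.preimage π Z.toSubmodule :=
      Submodule.ext fun _ => Z.proj_eq_zero
    rw [hk] at h2
    have := h1.1
    have := h2.1
    exact ⟨⟨Leib.isMultiplier_of_finrank_eq rfl, Leib.isMultiplier_of_finrank_eq h1.2⟩,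
      Leib.isMultiplier_of_finrank_eq rfl, Leib.isMultiplier_of_finrank_eq h2.2⟩
  · have hδ := (Leib.delta_eq_zero_iff Z.toSubmodule hZ).trans (Leib.deltaBil_eq_zero_iff _ hZ)
    tfae_have 1 ↔ 2 := by
      rw [hδ, Leib.beta_injective_iff π hZ, Leib.cocycles_vanish_iff_comm_le hF π hπ]
    tfae_have 1 ↔ 4 := by
      rw [hδ, Leib.subset_zStar_iff _ hZ]
    tfae_have 1 ↔ 3 := by
      have hsurj : Leib.delta Z.toSubmodule hZ = 0 ↔ Function.Surjective (Leib.inflation Z) := by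
        rw [Leib.delta_eq_zero_iff, ← LinearMap.ker_eq_top, ← Leib.range_inflation,
          LinearMap.range_eq_top]
      rw [hsurj]
      constructor
      · intro h
        obtain ⟨e⟩ : Nonempty (↥(Leib.derived 𝔽 L ⊓ Z.toSubmodule) ≃ₗ[𝔽]
            LinearMap.range (Leib.transgression Z hZ)) := by
          -- The image of transgression is dual to `L' ∩ Z`, hence of the same dimension.
          apply FiniteDimensional.nonempty_linearEquiv_of_finrank_eq
          obtain ⟨μ, hμ, hr⟩ := Leib.exists_range_transgression_eq Z hZ
          rw [hr, ← (Leib.finrank_of_range_tra _ _ μ hμ).2, Leib.ker_projHom, inf_comm]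
        have hr : LinearMap.range ((LinearMap.range (Leib.transgression Z hZ)).subtype ∘ₗ
            e.toLinearMap) = LinearMap.range (Leib.transgression Z hZ) := by
          rw [LinearMap.range_comp, LinearEquiv.range, Submodule.map_top, Submodule.range_subtype]
        refine ⟨_, Subtype.val_injective.comp e.injective, hr, ⟨?_⟩⟩
        exact ((Leib.inflation Z).quotKerEquivOfSurjective h).symm.trans
          (Submodule.quotEquivOfEq _ _ ((Leib.ker_inflation Z hZ).trans hr.symm))
      · rintro ⟨j, -, hj, ⟨e⟩⟩
        -- The quotient by `ker (inflation Z)` is the image of inflation; having the full finite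
        -- dimension, that image is all of `H²(L)`.
        have e' : Leib.H2 𝔽 L ≃ₗ[𝔽] LinearMap.range (Leib.inflation Z) :=
          (e.trans (Submodule.quotEquivOfEq _ _ (hj.trans (Leib.ker_inflation Z hZ).symm))).trans
            (Leib.inflation Z).quotKerEquivRange
        rw [← LinearMap.range_eq_top]
        exact Submodule.eq_top_of_finrank_eq e'.finrank_eq.symm
    tfae_finish
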